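/- Let $A$ and $B$ be commutative unital C*-algebras with Gel'fand spectra $X_A=\mathrm{Sp}(A)$, $X_B=\mathrm{Sp}(B)$. Let $M$ be an imprimitivity Hilbert C*-bimodule over $A$ and $B$. That is, $M$ is a unital $A$-$B$-bimodule on which the complex scalars of $A$ and of $B$ act in the same way, and it carries an $A$-valued inner product ${}_A\langle\cdot,\cdot\rangle$ ($A$-linear in the first variable) and a $B$-valued inner product $\langle\cdot,\cdot\rangle_B$ ($B$-linear in the second variable). Both inner products are Hermitian and positive definite, $M$ is complete for each of the norms $\|{}_A\langle x,x\rangle\|^{1/2}$ and $\|\langle x,x\rangle_B\|^{1/2}$, and $\langle x,ay\rangle_B=\langle a^*x,y\rangle_B$, ${}_A\langle xb,y\rangle={}_A\langle x,yb^*\rangle$. The values of each inner product span a dense subspace of $A$, respectively $B$ (fullness), and ${}_A\langle x,y\rangle\, z=x\,\langle y,z\rangle_B$ for all $x,y,z\in M$. Then there exist a homeomorphism $R_{BA}:X_A\to X_B$ and a Hermitian line bundle $E$ (a locally trivial complex line bundle with inner products on the fibres, antilinear in the first variable, that vary continuously) over the graph $\{(x,y)\in X_A\times X_B : y=R_{BA}(x)\}$,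 also denoted $R_{BA}$, with the following property. Let $\pi_A:R_{BA}\to X_A$ and $\pi_B:R_{BA}\to X_B$ be the projections, $\pi_A^\bullet(f)=f\circ\pi_A$ and $\pi_B^\bullet(g)=g\circ\pi_B$ the induced isomorphisms $C(X_A)\to C(R_{BA})$ and $C(X_B)\to C(R_{BA})$, and $\mathcal G_A:A\to C(X_A)$, $\mathcal G_B:B\to C(X_B)$ the Gel'fand transforms. On the space $\Gamma(R_{BA};E)$ of continuous sections put $$a\cdot\sigma=\pi_A^\bullet(\mathcal G_A(a))\,\sigma,\qquad \sigma\cdot b=\sigma\,\pi_B^\bullet(\mathcal G_B(b)),$$ $${}_A\langle\sigma,\tau\rangle=(\pi_A^\bullet\circ\mathcal G_A)^{-1}\big(p\mapsto\langle\tau(p),\sigma(p)\rangle_{E_p}\big),\qquad \langle\sigma,\tau\rangle_B=(\pi_B^\bullet\circ\mathcal G_B)^{-1}\big(p\mapsto\langle\sigma(p),\tau(p)\rangle_{E_p}\big).$$ Then $M$ is isomorphic to this bimodule ${}_{\pi_A^\bullet\circ\mathcal G_A}\Gamma(R_{BA};E)_{\pi_B^\bullet\circ\mathcal G_B}$ as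 an $A$-$B$ Hilbert C*-bimodule: there is an additive bijection $\Phi:M\to\Gamma(R_{BA};E)$ with $\Phi(axb)=a\cdot\Phi(x)\cdot b$ that preserves both inner products. -/

import Mathlib

open Bundle Topology MulOpposite WeakDual

/-! ### Hilbert C*-modules and bimodules

A right `B`-module is a `Module Bᵐᵒᵖ M`, and `x · b` is `op b • x`. -/

/-- An `A`-valued pairing `(x, y) ↦ ₐ⟨x, y⟩` on a left module. -/
class LeftPairing (A M : Type*) where
  linner : M → M → A

/-- A `B`-valued pairing `(x, y) ↦ ⟨x, y⟩_B` on a right module. -/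
class RightPairing (B M : Type*) where
  rinner : M → M → B

open LeftPairing RightPairing

/-- Left pre-Hilbert C*-module over `A`: the pairing is `A`-linear in the first variable. -/
structure IsLeftPreHilbert (A M : Type*) [CStarAlgebra A] [AddCommGroup M] [Module A M]
    [LeftPairing A M] : Prop where
  add_left : ∀ x y z : M, linner (A := A) (x + y) z = linner x z + linner y z
  smul_left : ∀ (a : A) (x y : M), linner (a • x) y = a * linner x y
  star_inner : ∀ x y : M, star (linner (A := A) x y) = linner y x
  inner_self_pos : ∀ x : M, ∃ c : A, linner x x = star c * c
  definite : ∀ x : M, linner (A := A) x x = 0 → x = 0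

/-- Right pre-Hilbert C*-module over `B`: the pairing is `B`-linear in the second variable. -/
structure IsRightPreHilbert (B M : Type*) [CStarAlgebra B] [AddCommGroup M] [Module Bᵐᵒᵖ M]
    [RightPairing B M] : Prop where
  add_right : ∀ x y z : M, rinner (B := B) z (x + y) = rinner z x + rinner z y
  smul_right : ∀ (b : B) (x y : M), rinner x (op b • y) = rinner x y * b
  star_inner : ∀ x y : M, star (rinner (B := B) x y) = rinner y x
  inner_self_pos : ∀ x : M, ∃ c : B, rinner x x = star c * c
  definite : ∀ x : M, rinner (B := B) x x = 0 → x = 0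

/-- The norm `‖ₐ⟨x, x⟩‖ ^ (1/2)` of a left pre-Hilbert C*-module. -/
noncomputable def leftNorm (A : Type*) {M : Type*} [CStarAlgebra A] [LeftPairing A M] (x : M) : ℝ :=
  √‖(linner x x : A)‖

/-- The norm `‖⟨x, x⟩_B‖ ^ (1/2)` of a right pre-Hilbert C*-module. -/
noncomputable def rightNorm (B : Type*) {M : Type*} [CStarAlgebra B] [RightPairing B M]
    (x : M) : ℝ :=
  √‖(rinner x x : B)‖

/-- Every sequence in `M` that is Cauchy for `N` converges for `N`. -/
def IsCompleteFor {M : Type*} [AddCommGroup M] (N : M → ℝ) : Prop :=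
  ∀ u : ℕ → M, (∀ ε > 0, ∃ n₀ : ℕ, ∀ m ≥ n₀, ∀ n ≥ n₀, N (u m - u n) < ε) →
    ∃ x : M, Filter.Tendsto (fun n => N (u n - x)) Filter.atTop (𝓝 0)

/-- Left Hilbert C*-module. -/
structure IsLeftHilbert (A M : Type*) [CStarAlgebra A] [AddCommGroup M] [Module A M]
    [LeftPairing A M] : Prop extends IsLeftPreHilbert A M where
  complete : IsCompleteFor (leftNorm A : M → ℝ)

/-- Right Hilbert C*-module. -/
structure IsRightHilbert (B M : Type*) [CStarAlgebra B] [AddCommGroup M] [Module Bᵐᵒᵖ M]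
    [RightPairing B M] : Prop extends IsRightPreHilbert B M where
  complete : IsCompleteFor (rightNorm B : M → ℝ)

/-- The values of the left pairing span a dense subspace of `A`. -/
def IsLeftFull (A M : Type*) [CStarAlgebra A] [LeftPairing A M] : Prop :=
  Dense (Submodule.span ℂ {a : A | ∃ x y : M, linner x y = a} : Set A)

/-- The values of the right pairing span a dense subspace of `B`. -/
def IsRightFull (B M : Type*) [CStarAlgebra B] [RightPairing B M] : Prop :=
  Dense (Submodule.span ℂ {b : B | ∃ x y : M, rinner x y = b} : Set B)

/-- Hilbert C*-bimodule. The field `scalar_smul` says that the complex scalars of `A` and of `B`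
act on `M` in the same way, so that `M` is a complex vector space. -/
structure IsHilbertBimodule (A B M : Type*) [CStarAlgebra A] [CStarAlgebra B] [AddCommGroup M]
    [Module A M] [Module Bᵐᵒᵖ M] [LeftPairing A M] [RightPairing B M] : Prop where
  left : IsLeftHilbert A M
  right : IsRightHilbert B M
  smul_smul : ∀ (a : A) (x : M) (b : B), op b • (a • x) = a • (op b • x)
  scalar_smul : ∀ (z : ℂ) (x : M), algebraMap ℂ A z • x = op (algebraMap ℂ B z) • x
  rinner_smul : ∀ (a : A) (x y : M), rinner (B := B) x (a • y) = rinner (star a • x) y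
  linner_smul : ∀ (b : B) (x y : M), linner (A := A) (op b • x) y = linner x (op (star b) • y)

/-- Imprimitivity bimodule: a full Hilbert C*-bimodule with `ₐ⟨x, y⟩ · z = x · ⟨y, z⟩_B`. -/
structure IsImprimitivityBimodule (A B M : Type*) [CStarAlgebra A] [CStarAlgebra B]
    [AddCommGroup M] [Module A M] [Module Bᵐᵒᵖ M] [LeftPairing A M] [RightPairing B M] : Prop
    extends IsHilbertBimodule A B M where
  left_full : IsLeftFull A M
  right_full : IsRightFull B M
  imprimitivity : ∀ x y z : M, (linner x y : A) • z = op (rinner y z : B) • x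

/-- Isomorphism of Hilbert C*-bimodules: a bijection that preserves both module structures and
both pairings. -/
structure HilbertBimoduleIso (A B M N : Type*) [CStarAlgebra A] [CStarAlgebra B]
    [AddCommGroup M] [Module A M] [Module Bᵐᵒᵖ M] [LeftPairing A M] [RightPairing B M]
    [AddCommGroup N] [Module A N] [Module Bᵐᵒᵖ N] [LeftPairing A N] [RightPairing B N]
    extends M ≃+ N where
  map_smul_left : ∀ (a : A) (x : M), toFun (a • x) = a • toFun x
  map_smul_right : ∀ (b : B) (x : M), toFun (op b • x) = op b • toFun x
  map_linner : ∀ x y : M, linner (A := A) (toFun x) (toFun y) = linner x y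
  map_rinner : ∀ x y : M, rinner (B := B) (toFun x) (toFun y) = rinner x y

/-! ### Twisting by isomorphisms -/

section Twist

variable {A B A' B' : Type*} [Semiring A] [Algebra ℂ A] [Star A] [Semiring B] [Algebra ℂ B] [Star B]
  [Semiring A'] [Algebra ℂ A'] [Star A'] [Semiring B'] [Algebra ℂ B'] [Star B']

/-- The `A'`-`B'`-bimodule `N`, twisted on the left by `α : A → A'` and on the right by
`β : B → B'`: an `A`-`B`-bimodule with the same underlying group. -/
def Twist (_α : A ≃⋆ₐ[ℂ] A') (_β : B ≃⋆ₐ[ℂ] B') (N : Type*) : Type _ := N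

variable (α : A ≃⋆ₐ[ℂ] A') (β : B ≃⋆ₐ[ℂ] B') (N : Type*)

instance [AddCommGroup N] : AddCommGroup (Twist α β N) := inferInstanceAs (AddCommGroup N)

/-- `a · x := α(a) · x` -/
instance [AddCommGroup N] [Module A' N] : Module A (Twist α β N) :=
  Module.compHom N (α : A →+* A')

/-- `x · b := x · β(b)` -/
instance [AddCommGroup N] [Module B'ᵐᵒᵖ N] : Module Bᵐᵒᵖ (Twist α β N) :=
  Module.compHom N (RingHom.op (β : B →+* B'))

/-- `ₐ⟨x, y⟩ := α⁻¹(ₐ'⟨x, y⟩)` -/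
instance [LeftPairing A' N] : LeftPairing A (Twist α β N) where
  linner x y := α.symm (linner (M := N) x y)

/-- `⟨x, y⟩_B := β⁻¹(⟨x, y⟩_B')` -/
instance [RightPairing B' N] : RightPairing B (Twist α β N) where
  rinner x y := β.symm (rinner (M := N) x y)

end Twist

/-! ### Hermitian line bundles and their sections -/

universe u v

/-- A Hermitian line bundle over `X`: a locally trivial complex vector bundle with model fibre `ℂ`
whose fibres carry inner products (antilinear in the first variable) that depend continuously on
the base point, i.e. that form a continuous function on the fibre product `E ×_X E`. -/
structure HermitianLineBundle (X : Type u) [TopologicalSpace X] where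
  fiber : X → Type v
  [normedAddCommGroup : ∀ x, NormedAddCommGroup (fiber x)]
  [innerProductSpace : ∀ x, InnerProductSpace ℂ (fiber x)]
  [topologicalSpace : TopologicalSpace (TotalSpace ℂ fiber)]
  [fiberBundle : FiberBundle ℂ fiber]
  [vectorBundle : VectorBundle ℂ ℂ fiber]
  continuous_inner :
    Continuous fun p : TotalSpace (ℂ × ℂ) (fiber ×ᵇ fiber) => inner ℂ p.2.1 p.2.2

namespace HermitianLineBundle

attribute [instance] normedAddCommGroup innerProductSpace topologicalSpace fiberBundle vectorBundle

variable {X : Type u} [TopologicalSpace X] (L : HermitianLineBundle.{u, v} X)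

theorem continuous_section_iff (σ : ∀ x, L.fiber x) :
    Continuous (fun x => TotalSpace.mk' ℂ x (σ x)) ↔
      ∀ x₀, ContinuousAt (fun x => (trivializationAt ℂ L.fiber x₀ ⟨x, σ x⟩).2) x₀ := by
  rw [continuous_iff_continuousAt]
  refine forall_congr' fun x₀ => ?_
  rw [FiberBundle.continuousAt_totalSpace]
  exact and_iff_right continuousAt_id

theorem eventually_mem_baseSet (x₀ : X) :
    ∀ᶠ x in 𝓝 x₀, x ∈ (trivializationAt ℂ L.fiber x₀).baseSet :=
  (trivializationAt ℂ L.fiber x₀).open_baseSet.mem_nhds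
    (FiberBundle.mem_baseSet_trivializationAt' x₀)

theorem continuous_smul_section {σ : ∀ x, L.fiber x} (f : C(X, ℂ))
    (hσ : Continuous (fun x => TotalSpace.mk' ℂ x (σ x))) :
    Continuous (fun x => TotalSpace.mk' ℂ x (f x • σ x)) := by
  rw [continuous_section_iff] at hσ ⊢
  intro x₀
  refine (f.continuous.continuousAt.smul (hσ x₀)).congr ?_
  filter_upwards [L.eventually_mem_baseSet x₀] with x hx
  exact (((trivializationAt ℂ L.fiber x₀).linear ℂ hx).map_smul (f x) (σ x)).symm

theorem continuous_add_section {σ τ : ∀ x, L.fiber x}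
    (hσ : Continuous (fun x => TotalSpace.mk' ℂ x (σ x)))
    (hτ : Continuous (fun x => TotalSpace.mk' ℂ x (τ x))) :
    Continuous (fun x => TotalSpace.mk' ℂ x (σ x + τ x)) := by
  rw [continuous_section_iff] at hσ hτ ⊢
  intro x₀
  refine ((hσ x₀).add (hτ x₀)).congr ?_
  filter_upwards [L.eventually_mem_baseSet x₀] with x hx
  exact (((trivializationAt ℂ L.fiber x₀).linear ℂ hx).map_add (σ x) (τ x)).symm

theorem continuous_zero_section : Continuous (fun x => TotalSpace.mk' ℂ x (0 : L.fiber x)) := by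
  rw [continuous_section_iff]
  intro x₀
  refine (continuousAt_const (y := (0 : ℂ))).congr ?_
  filter_upwards [L.eventually_mem_baseSet x₀] with x hx
  exact (((trivializationAt ℂ L.fiber x₀).linear ℂ hx).map_zero).symm

/-- The additive group `Γ(X; E)` of continuous sections. -/
def Sections : AddSubgroup (∀ x, L.fiber x) where
  carrier := {σ | Continuous (fun x => TotalSpace.mk' ℂ x (σ x))}
  add_mem' hσ hτ := L.continuous_add_section hσ hτ
  zero_mem' := L.continuous_zero_section
  neg_mem' {σ} hσ := by
    have h := L.continuous_smul_section (-1) hσ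
    simpa using h

/-- `(f · σ)(x) = f(x) σ(x)` -/
noncomputable instance : Module C(X, ℂ) L.Sections where
  smul f σ := ⟨fun x => f x • σ.1 x, L.continuous_smul_section f σ.2⟩
  one_smul σ := Subtype.ext (funext fun x => one_smul ℂ (σ.1 x))
  mul_smul f g σ := Subtype.ext (funext fun x => mul_smul (f x) (g x) (σ.1 x))
  smul_zero f := Subtype.ext (funext fun x => smul_zero (f x))
  smul_add f σ τ := Subtype.ext (funext fun x => smul_add (f x) (σ.1 x) (τ.1 x))
  add_smul f g σ := Subtype.ext (funext fun x => add_smul (f x) (g x) (σ.1 x))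
  zero_smul σ := Subtype.ext (funext fun x => zero_smul ℂ (σ.1 x))

/-- The symmetric right module structure `(σ · f)(x) = σ(x) f(x)`. -/
noncomputable instance : Module C(X, ℂ)ᵐᵒᵖ L.Sections :=
  Module.compHom L.Sections ((RingHom.id C(X, ℂ)).fromOpposite fun f g => mul_comm f g)

theorem continuous_inner_sections (σ τ : L.Sections) :
    Continuous fun x => inner ℂ (σ.1 x) (τ.1 x) := by
  have h : Continuous fun x =>
      (⟨x, (σ.1 x, τ.1 x)⟩ : TotalSpace (ℂ × ℂ) (L.fiber ×ᵇ L.fiber)) :=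
    (FiberBundle.Prod.isInducing_diag ℂ L.fiber ℂ L.fiber).continuous_iff.2
      (Continuous.prodMk σ.2 τ.2)
  exact L.continuous_inner.comp h

/-- The right pairing `⟨σ, τ⟩(x) = ⟨σ(x), τ(x)⟩`, linear in `τ`. -/
noncomputable instance : RightPairing C(X, ℂ) L.Sections where
  rinner σ τ := ⟨fun x => inner ℂ (σ.1 x) (τ.1 x), L.continuous_inner_sections σ τ⟩

/-- The left pairing `⟨σ, τ⟩(x) = ⟨τ(x), σ(x)⟩`, linear in `σ`. -/
noncomputable instance : LeftPairing C(X, ℂ) L.Sections where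
  linner σ τ := ⟨fun x => inner ℂ (τ.1 x) (σ.1 x), L.continuous_inner_sections τ σ⟩

end HermitianLineBundle

/-! ### The bimodule of a bundle over the graph of a homeomorphism -/

section Graph

variable {X Y : Type*} [TopologicalSpace X] [TopologicalSpace Y]

/-- The graph of a homeomorphism, as a subspace of `X × Y`. -/
def homeoGraph (R : X ≃ₜ Y) : Set (X × Y) := {p | R p.1 = p.2}

/-- The projection of the graph onto `X`. -/
def graphFst (R : X ≃ₜ Y) : homeoGraph R ≃ₜ X where
  toFun p := p.1.1
  invFun x := ⟨(x, R x), rfl⟩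
  left_inv p := Subtype.ext (Prod.ext rfl p.2)
  right_inv _ := rfl
  continuous_toFun := by fun_prop
  continuous_invFun := by fun_prop

/-- The projection of the graph onto `Y`. -/
def graphSnd (R : X ≃ₜ Y) : homeoGraph R ≃ₜ Y where
  toFun p := p.1.2
  invFun y := ⟨(R.symm y, y), R.apply_symm_apply y⟩
  left_inv p := Subtype.ext (Prod.ext (R.symm_apply_eq.2 (Eq.symm p.2)) rfl)
  right_inv _ := rfl
  continuous_toFun := by fun_prop
  continuous_invFun := by fun_prop

/-- The `C(X)`-`C(Y)`-bimodule associated to a Hermitian line bundle over the graph of `R`: the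
continuous sections, twisted by the pull-backs along the two projections of the graph. -/
abbrev AssociatedBimodule (R : X ≃ₜ Y) (L : HermitianLineBundle.{_, v} (homeoGraph R)) : Type _ :=
  Twist ((graphFst R).compStarAlgEquiv' ℂ ℂ) ((graphSnd R).compStarAlgEquiv' ℂ ℂ) L.Sections

end Graph

/-! ### The line bundle of a kernel of rank one -/

/-! By imprimitivity `ₐ⟨x,y⟩ ₐ⟨z,u⟩ v = x (⟨y,z⟩_B ⟨u,v⟩_B)`, so commutativity of `B` lets the pairs
`(y,z)` and `(u,v)` be exchanged (`linner_exchange`). Evaluated at a character `χ` of `A`, this says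
that the left pairing has rank one: `M` has a one-dimensional fibre at `χ`, spanned by a unit vector
`e`. The algebra `B` acts on that fibre by a scalar, that is, by a character of `B`; this gives the
map of spectra, and fullness on both sides makes it a homeomorphism. The fibres form a Hermitian
line bundle: each `e` remains a local frame near its character, and ratios of inner products are the
transition functions. Each `x` in `M` gives a section. Every section arises in this way, because
`ₐ⟨x,y⟩ σ` is a multiple of the section of `x` (`ker_smul_section`) and the inner products generate
the unit ideal of `A` (`span_linner`). -/

/-- A Hermitian kernel on `M` with values in `C(X, ℂ)` that has rank one at every point of `X`,
together with a choice of a unit vector `frame p : M` at every point `p`. -/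
structure RankOneKernel (M : Type*) (X : Type u) [TopologicalSpace X] where
  ker : M → M → C(X, ℂ)
  conj_symm : ∀ x y p, star (ker x y p) = ker y x p
  exchange : ∀ x y v w p, ker x w p * ker v y p = ker x y p * ker v w p
  frame : X → M
  frame_self : ∀ p, ker (frame p) (frame p) p = 1

namespace RankOneKernel

variable {M : Type*} {X : Type u} [TopologicalSpace X] (K : RankOneKernel M X)

theorem ker_eq_mul (x y : M) (p : X) :
    K.ker x y p = K.ker x (K.frame p) p * K.ker (K.frame p) y p := by
  rw [K.exchange, K.frame_self, mul_one]

/-- The diagonal value at `p` of the unit vector chosen at `i`. -/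
def diag (i : X) : C(X, ℂ) := K.ker (K.frame i) (K.frame i)

theorem diag_self (i : X) : K.diag i i = 1 := K.frame_self i

/-- The vector bundle with fibre `ℂ`, in which `frame i` is a local frame wherever its diagonal
value does not vanish. -/
noncomputable def core : VectorBundleCore ℂ X ℂ X where
  baseSet i := {p | K.diag i p ≠ 0}
  isOpen_baseSet i := isOpen_ne_fun (K.diag i).continuous continuous_const
  -- The fibre at `p` is coordinatised by `frame p`, a unit vector there, though `frame` need not be
  -- continuous in `p`.
  indexAt := id
  mem_baseSet_at p := by simp [diag_self]
  -- In a one-dimensional fibre, `frame i` is its projection onto `frame j`, which gives this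
  -- factor.
  coordChange i j p := (K.ker (K.frame i) (K.frame j) p / K.diag j p) • ContinuousLinearMap.id ℂ ℂ
  coordChange_self i p hp v := by
    have h : K.ker (K.frame i) (K.frame i) p / K.diag i p = 1 := div_self hp
    simp [h]
  continuousOn_coordChange i j :=
    ((K.ker _ _).continuous.continuousOn.div (K.diag j).continuous.continuousOn
      fun _ hp => hp.2).smul continuousOn_const
  coordChange_comp i j k p hp v := by
    obtain ⟨⟨-, hj⟩, hk⟩ := hp
    -- The cocycle identity with denominators cleared.
    have h := K.exchange (K.frame i) (K.frame j) (K.frame j) (K.frame k) p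
    have hj' : K.ker (K.frame j) (K.frame j) p ≠ 0 := hj
    have hk' : K.ker (K.frame k) (K.frame k) p ≠ 0 := hk
    simp only [diag, _root_.smul_apply, ContinuousLinearMap.id_apply, smul_eq_mul]
    field_simp
    linear_combination (-v) * h

/-- The coordinate of `v` in the fibre at `p`, with respect to the frame chosen at `i`. -/
theorem trivializationAt_apply (i : X) (q : TotalSpace ℂ K.core.Fiber) :
    (trivializationAt ℂ K.core.Fiber i q).2 =
      K.ker (K.frame q.1) (K.frame i) q.1 / K.diag i q.1 * (show ℂ from q.2) :=
  rfl

/-- Since `frame p` is a unit vector, the squared modulus of its pairing with `frame i` at `p` is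
`diag i p`. The formula exhibits the metric in coordinates that are continuous near `i`. -/
theorem inner_eq_trivializationAt (i : X) {p : X} (hp : K.diag i p ≠ 0) (v w : ℂ) :
    inner ℂ v w =
      star (trivializationAt ℂ K.core.Fiber i ⟨p, v⟩).2 *
        (trivializationAt ℂ K.core.Fiber i ⟨p, w⟩).2 * K.diag i p := by
  have h : K.diag i p = K.ker (K.frame i) (K.frame p) p * K.ker (K.frame p) (K.frame i) p :=
    K.ker_eq_mul _ _ _
  have hs : star (K.diag i p) = K.diag i p := K.conj_symm _ _ _
  have hinner : inner ℂ v w = w * star v := rfl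
  rw [hinner, trivializationAt_apply, trivializationAt_apply, star_mul', star_div₀, hs, K.conj_symm]
  change w * star v = K.ker (K.frame i) (K.frame p) p / K.diag i p * star v *
    (K.ker (K.frame p) (K.frame i) p / K.diag i p * w) * K.diag i p
  field_simp
  rw [h]
  ring

/-- The Hermitian line bundle of a kernel of rank one. -/
noncomputable def lineBundle : HermitianLineBundle.{u, 0} X where
  fiber := K.core.Fiber
  normedAddCommGroup _ := inferInstanceAs (NormedAddCommGroup ℂ)
  innerProductSpace _ := inferInstanceAs (InnerProductSpace ℂ ℂ)
  topologicalSpace := K.core.toTopologicalSpace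
  fiberBundle := K.core.fiberBundle
  vectorBundle := K.core.vectorBundle
  continuous_inner := by
    rw [continuous_iff_continuousAt]
    intro q₀
    have hdiag := (FiberBundle.Prod.isInducing_diag ℂ K.core.Fiber ℂ K.core.Fiber).continuous
    have hproj : Continuous fun q : TotalSpace (ℂ × ℂ) (K.core.Fiber ×ᵇ K.core.Fiber) => q.1 :=
      K.core.continuous_proj.comp (continuous_fst.comp hdiag)
    have h₁ := ((FiberBundle.continuousAt_totalSpace ℂ _).1
      ((continuous_fst.comp hdiag).continuousAt (x := q₀))).2
    have h₂ := ((FiberBundle.continuousAt_totalSpace ℂ _).1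
      ((continuous_snd.comp hdiag).continuousAt (x := q₀))).2
    refine ((h₁.star.mul h₂).mul
      ((K.diag q₀.1).continuous.comp hproj).continuousAt).congr ?_
    have hne : ∀ᶠ q in 𝓝 q₀, K.diag q₀.1 q.1 ≠ 0 :=
      hproj.continuousAt.eventually
        ((K.core.isOpen_baseSet q₀.1).mem_nhds (K.core.mem_baseSet_at q₀.1))
    filter_upwards [hne] with q hq
    exact (K.inner_eq_trivializationAt q₀.1 hq q.2.1 q.2.2).symm

/-- The section of the line bundle defined by an element of `M`. -/
noncomputable def toSection (x : M) : K.lineBundle.Sections :=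
  ⟨fun p => (K.ker x (K.frame p) p : ℂ), by
    refine (K.lineBundle.continuous_section_iff _).2 fun i => ?_
    -- In the frame at `i` the possibly discontinuous `frame p` cancels from the coordinate.
    have h : ContinuousAt (fun p => K.ker x (K.frame i) p / K.diag i p) i :=
      (K.ker _ _).continuous.continuousAt.div (K.diag i).continuous.continuousAt
        (by simp [diag_self])
    refine h.congr (Filter.Eventually.of_forall fun p => ?_)
    change K.ker x (K.frame i) p / K.diag i p =
      K.ker (K.frame p) (K.frame i) p / K.diag i p * K.ker x (K.frame p) p
    rw [K.ker_eq_mul x (K.frame i)]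
    ring⟩

theorem inner_toSection (x y : M) (p : X) :
    inner ℂ ((K.toSection x).1 p) ((K.toSection y).1 p) = K.ker y x p := by
  change K.ker y (K.frame p) p * star (K.ker x (K.frame p) p) = _
  rw [K.conj_symm, ← K.ker_eq_mul]

/-- A kernel of rank one multiplies a section through its inner product with a section that comes
from `M`. -/
theorem ker_smul_section (x y : M) (σ : K.lineBundle.Sections) :
    K.ker x y • σ = (rinner (K.toSection y) σ : C(X, ℂ)) • K.toSection x := by
  refine Subtype.ext (funext fun p => ?_)
  change K.ker x y p * (show ℂ from σ.1 p) =
    (show ℂ from σ.1 p) * star (K.ker y (K.frame p) p) * K.ker x (K.frame p) p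
  rw [K.conj_symm, K.ker_eq_mul x y]
  ring

end RankOneKernel

/-! ### Imprimitivity bimodules over commutative C*-algebras -/

namespace IsImprimitivityBimodule

section CStarAlgebra

variable {A B M : Type*} [CStarAlgebra A] [CStarAlgebra B] [AddCommGroup M]
    [Module A M] [Module Bᵐᵒᵖ M] [LeftPairing A M] [RightPairing B M]
    (hM : IsImprimitivityBimodule A B M)
include hM

theorem linner_add_left (x y z : M) : linner (A := A) (x + y) z = linner x z + linner y z :=
  hM.left.add_left x y z

theorem linner_smul_left (a : A) (x y : M) : linner (a • x) y = a * linner x y :=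
  hM.left.smul_left a x y

theorem star_linner (x y : M) : star (linner (A := A) x y) = linner y x :=
  hM.left.star_inner x y

theorem linner_smul_right (a : A) (x y : M) : linner x (a • y) = linner x y * star a := by
  rw [← hM.star_linner, hM.linner_smul_left, star_mul, hM.star_linner]

theorem linner_op_smul_left (b : B) (x y : M) :
    linner (A := A) (op b • x) y = linner x (op (star b) • y) :=
  hM.linner_smul b x y

theorem rinner_op_smul_right (b : B) (x y : M) : rinner x (op b • y) = rinner x y * b :=
  hM.right.smul_right b x y

theorem linner_mul_linner (x y z w : M) :
    linner (A := A) x y * linner z w = linner (op (rinner y z : B) • x) w := by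
  rw [← hM.imprimitivity, hM.linner_smul_left]

theorem linner_zero_left (x : M) : linner (A := A) 0 x = 0 := by
  simpa using hM.linner_smul_left (0 : A) 0 x

theorem rinner_zero_right (x : M) : rinner (B := B) x 0 = 0 := by
  simpa using hM.rinner_op_smul_right (0 : B) x 0

theorem linner_sub_left (x y z : M) : linner (A := A) (x - y) z = linner x z - linner y z := by
  rw [eq_sub_iff_add_eq, ← hM.linner_add_left, sub_add_cancel]

theorem linner_sub_right (x y z : M) : linner (A := A) z (x - y) = linner z x - linner z y := by
  rw [← hM.star_linner, hM.linner_sub_left, star_sub, hM.star_linner, hM.star_linner]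

/-- Elements with the same left inner products are equal. -/
theorem ext_linner {x y : M} (h : ∀ z : M, linner (A := A) z x = linner z y) : x = y := by
  refine sub_eq_zero.1 (hM.left.definite _ ?_)
  rw [hM.linner_sub_right, h, sub_self]

end CStarAlgebra

section CommCStarAlgebra

variable {A B M : Type*} [CommCStarAlgebra A] [CommCStarAlgebra B] [AddCommGroup M]
    [Module A M] [Module Bᵐᵒᵖ M] [LeftPairing A M] [RightPairing B M]
    (hM : IsImprimitivityBimodule A B M)
include hM

/-! ### Fullness and the rank-one identity -/

/-- Over commutative algebras the left inner products generate the unit ideal. -/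
theorem span_linner : Ideal.span {a : A | ∃ x y : M, linner x y = a} = ⊤ := by
  by_contra hne
  -- In a unital Banach algebra the closure of a proper ideal is proper, so a dense ideal is
  -- everything.
  refine Ideal.closure_ne_top _ hne ?_
  rw [Ideal.eq_top_iff_one]
  have hle : (Submodule.span ℂ {a : A | ∃ x y : M, linner x y = a} : Set A) ⊆
      Ideal.span {a : A | ∃ x y : M, linner x y = a} := by
    have := Submodule.span_le_restrictScalars ℂ A {a : A | ∃ x y : M, linner x y = a}
    exact this
  exact closure_mono hle (hM.left_full 1)

theorem span_rinner : Ideal.span {b : B | ∃ x y : M, rinner x y = b} = ⊤ := by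
  by_contra hne
  refine Ideal.closure_ne_top _ hne ?_
  rw [Ideal.eq_top_iff_one]
  have hle : (Submodule.span ℂ {b : B | ∃ x y : M, rinner x y = b} : Set B) ⊆
      Ideal.span {b : B | ∃ x y : M, rinner x y = b} := by
    have := Submodule.span_le_restrictScalars ℂ B {b : B | ∃ x y : M, rinner x y = b}
    exact this
  exact closure_mono hle (hM.right_full 1)

/-- Commutativity of `B` forces the left inner product to have rank one. -/
theorem linner_exchange (x y z u v w : M) :
    linner (A := A) x y * linner z u * linner v w = linner x u * linner v y * linner z w := by
  have h : ∀ y z u v : M, (linner (A := A) x y * linner z u) • v =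
      op (rinner y z * rinner u v : B) • x := fun y z u v => by
    rw [hM.linner_mul_linner, hM.imprimitivity, ← mul_smul, ← op_mul]
  rw [← hM.linner_smul_left, h, mul_comm (rinner y z), ← h, hM.linner_smul_left]

/-! ### The fibre of `M` at a character of `A` -/

section Character

variable (χ : characterSpace ℂ A)

theorem exists_linner_ne_zero : ∃ x y : M, χ (linner x y) ≠ 0 := by
  by_contra! h
  have hle : Ideal.span {a : A | ∃ x y : M, linner x y = a} ≤ RingHom.ker χ := by
    rw [Ideal.span_le]
    rintro _ ⟨x, y, rfl⟩
    exact h x y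
  rw [hM.span_linner] at hle
  exact one_ne_zero ((map_one χ).symm.trans (hle (Submodule.mem_top (x := (1 : A)))))

theorem exists_rinner_ne_zero (ψ : characterSpace ℂ B) : ∃ x y : M, ψ (rinner x y) ≠ 0 := by
  by_contra! h
  have hle : Ideal.span {b : B | ∃ x y : M, rinner x y = b} ≤ RingHom.ker ψ := by
    rw [Ideal.span_le]
    rintro _ ⟨x, y, rfl⟩
    exact h x y
  rw [hM.span_rinner] at hle
  exact one_ne_zero ((map_one ψ).symm.trans (hle (Submodule.mem_top (x := (1 : B)))))

/-- At every character of `A` there is an element of `M` of length one. -/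
theorem exists_linner_self_eq_one : ∃ e : M, χ (linner e e) = 1 := by
  obtain ⟨x, y, hxy⟩ := hM.exists_linner_ne_zero χ
  -- A substitute for Cauchy–Schwarz: exchange gives `⟨x,y⟩⟨y,x⟩⟨x,y⟩ = ⟨x,x⟩⟨x,y⟩⟨y,y⟩`.
  have hx : χ (linner x x) ≠ 0 := fun h0 => by
    have h := congrArg χ (hM.linner_exchange x y y x x y)
    have hyx : χ (linner y x) ≠ 0 := by
      rw [← hM.star_linner, map_star]
      exact star_ne_zero.2 hxy
    simp only [map_mul, h0, zero_mul] at h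
    exact mul_ne_zero (mul_ne_zero hxy hyx) hxy h
  obtain ⟨c, hc⟩ := hM.left.inner_self_pos x
  rw [hc, map_mul] at hx
  have hcs : star (χ c) ≠ 0 := by
    rw [← map_star]
    exact left_ne_zero_of_mul hx
  have hc0 : χ c ≠ 0 := right_ne_zero_of_mul hx
  have hχ : ∀ t : ℂ, χ (algebraMap ℂ A t) = t := fun t => AlgHomClass.commutes χ t
  -- As `⟨x,x⟩ = c* c`, the length of `x` at `χ` is `|χ c|`.
  refine ⟨algebraMap ℂ A (χ c)⁻¹ • x, ?_⟩
  rw [hM.linner_smul_left, hM.linner_smul_right, hc]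
  simp only [map_mul, map_star, hχ, star_inv₀]
  field_simp

/-- An element of length one at the character `χ`. -/
noncomputable def unitAt : M := (hM.exists_linner_self_eq_one χ).choose

theorem linner_unitAt : χ (linner (hM.unitAt χ) (hM.unitAt χ)) = 1 :=
  (hM.exists_linner_self_eq_one χ).choose_spec

theorem apply_linner_eq_mul (x y : M) :
    χ (linner x y) = χ (linner x (hM.unitAt χ)) * χ (linner (hM.unitAt χ) y) := by
  have h := congrArg χ (hM.linner_exchange (hM.unitAt χ) (hM.unitAt χ) x (hM.unitAt χ)
    (hM.unitAt χ) y)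
  simp only [map_mul, hM.linner_unitAt, one_mul] at h
  exact h.symm

theorem apply_linner_exchange (x y v w : M) :
    χ (linner x w) * χ (linner v y) = χ (linner x y) * χ (linner v w) := by
  rw [hM.apply_linner_eq_mul χ x w, hM.apply_linner_eq_mul χ v y, hM.apply_linner_eq_mul χ x y,
    hM.apply_linner_eq_mul χ v w]
  ring

theorem op_algebraMap_smul (t : ℂ) (x : M) :
    op (algebraMap ℂ B t) • x = algebraMap ℂ A t • x :=
  (hM.scalar_smul t x).symm

/-- The action of `B` on the fibre of `M` at a character `χ` of `A`. -/
noncomputable def fiberAlgHom : B →ₐ[ℂ] ℂ where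
  toFun b := χ (linner (op b • hM.unitAt χ) (hM.unitAt χ))
  map_one' := by rw [op_one, one_smul, hM.linner_unitAt]
  -- One factor moves to the second slot as an adjoint, the pairing splits at the unit vector, and
  -- the factor moves back.
  map_mul' b b' := by
    rw [mul_comm b b', op_mul, mul_smul, hM.linner_op_smul_left b, hM.apply_linner_eq_mul χ,
      ← hM.linner_op_smul_left b]
    exact mul_comm _ _
  map_zero' := by rw [op_zero, zero_smul, hM.linner_zero_left, map_zero]
  map_add' b b' := by rw [op_add, add_smul, hM.linner_add_left, map_add]
  commutes' t := by
    rw [hM.op_algebraMap_smul, hM.linner_smul_left, map_mul, hM.linner_unitAt, mul_one]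
    exact AlgHomClass.commutes χ t

/-- The character of `B` through which `B` acts on the fibre of `M` at a character of `A`. -/
noncomputable def characterMap : characterSpace ℂ B :=
  CharacterSpace.equivAlgHom.symm (hM.fiberAlgHom χ)

theorem characterMap_apply (b : B) :
    hM.characterMap χ b = χ (linner (op b • hM.unitAt χ) (hM.unitAt χ)) :=
  rfl

theorem apply_linner_op_smul (b : B) (x y : M) :
    χ (linner (op b • x) y) = hM.characterMap χ b * χ (linner x y) := by
  rw [hM.apply_linner_eq_mul χ (op b • x), hM.linner_op_smul_left, hM.apply_linner_eq_mul χ x,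
    ← hM.linner_op_smul_left, ← hM.characterMap_apply, hM.apply_linner_eq_mul χ x y]
  ring

/-- With `e` the unit vector, `e ⟨x,y⟩_B = ₐ⟨e,x⟩ y`, and rank one removes `e`. This ties the two
pairings together across the map of spectra. -/
theorem characterMap_rinner (x y : M) :
    hM.characterMap χ (rinner x y) = χ (linner y x) := by
  rw [hM.characterMap_apply, ← hM.linner_mul_linner, map_mul, mul_comm, ← hM.apply_linner_eq_mul]

end Character

/-! ### The homeomorphism of spectra -/

theorem continuous_characterMap : Continuous hM.characterMap := by
  refine continuous_induced_rng.2 (WeakDual.continuous_of_continuous_eval fun b => ?_)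
  rw [continuous_iff_continuousAt]
  intro χ₀
  have hc : ∀ a : A, Continuous fun χ : characterSpace ℂ A => χ a := fun a =>
    (gelfandTransform ℂ A a).continuous
  -- One vector is kept fixed near `χ₀`, and the quotient by `χ ⟨e,e⟩` replaces the varying unit
  -- vectors.
  set e := hM.unitAt χ₀
  have he : χ₀ (linner e e) ≠ 0 := by
    rw [hM.linner_unitAt]
    exact one_ne_zero
  refine ((hc (linner (op b • e) e)).continuousAt.div (hc (linner e e)).continuousAt he).congr ?_
  filter_upwards [(hc (linner e e)).continuousAt.eventually_ne he] with χ hχ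
  change χ (linner (op b • e) e) / χ (linner e e) = hM.characterMap χ b
  rw [hM.apply_linner_op_smul]
  exact mul_div_cancel_right₀ _ hχ

/-- The image character determines `χ` on all left inner products, hence `χ a` as the ratio of `χ
⟨ax,y⟩` to a nonzero `χ ⟨x,y⟩`. -/
theorem injective_characterMap : Function.Injective hM.characterMap := by
  intro χ₁ χ₂ h
  obtain ⟨x, y, hxy⟩ := hM.exists_linner_ne_zero χ₁
  have hxy' : χ₂ (linner x y) = χ₁ (linner x y) := by
    rw [← hM.characterMap_rinner, ← hM.characterMap_rinner, h]
  refine CharacterSpace.ext fun a => mul_right_cancel₀ hxy ?_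
  rw [← map_mul, ← hM.linner_smul_left, ← hM.characterMap_rinner, h, hM.characterMap_rinner,
    hM.linner_smul_left, map_mul, hxy']

/-- An element of `B` that vanishes at all characters that come from `A` is zero. -/
theorem eq_zero_of_characterMap (b : B) (h : ∀ χ, hM.characterMap χ b = 0) : b = 0 := by
  -- Such a `b` annihilates every fibre, hence `M`; right fullness then forces `b = 0`.
  have hb : ∀ x : M, op b • x = 0 := fun x => by
    refine hM.left.definite _ ((gelfandTransform_bijective A).1 ?_)
    ext χ
    simp only [map_zero, gelfandTransform_apply_apply, hM.apply_linner_op_smul, h, zero_mul,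
      ContinuousMap.zero_apply]
  refine (gelfandTransform_bijective B).1 ?_
  ext ψ
  obtain ⟨x, y, hxy⟩ := hM.exists_rinner_ne_zero ψ
  have h0 := congrArg ψ (hM.rinner_op_smul_right b x y)
  rw [hb, hM.rinner_zero_right, map_zero, map_mul] at h0
  simpa [hxy] using h0.symm

/-- The range is compact, hence closed. If it missed `ψ`, a Urysohn function vanishing on it and
equal to 1 at `ψ` would be the Gelfand transform of a nonzero `b` excluded by
`eq_zero_of_characterMap`. -/
theorem surjective_characterMap : Function.Surjective hM.characterMap := by
  intro ψ
  by_contra hψ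
  have hcl : IsClosed (Set.range hM.characterMap) :=
    (isCompact_range hM.continuous_characterMap).isClosed
  obtain ⟨f, hf₀, hf₁, -⟩ := exists_continuous_zero_one_of_isClosed hcl
    (isClosed_singleton (x := ψ)) (Set.disjoint_singleton_right.2 hψ)
  obtain ⟨b, hb⟩ := (gelfandTransform_bijective B).2 ⟨fun p => (f p : ℂ), by fun_prop⟩
  have hbp : ∀ p : characterSpace ℂ B, p b = f p := fun p => congrArg (fun g => g p) hb
  have hb0 := hM.eq_zero_of_characterMap b fun χ => by
    rw [hbp, hf₀ ⟨χ, rfl⟩]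
    simp
  have := hbp ψ
  rw [hb0, map_zero, hf₁ rfl] at this
  simp at this

/-- The homeomorphism of Gelfand spectra defined by an imprimitivity bimodule. -/
noncomputable def spectrumHomeo : characterSpace ℂ A ≃ₜ characterSpace ℂ B :=
  Continuous.homeoOfEquivCompactToT2
    (f := Equiv.ofBijective _ ⟨hM.injective_characterMap, hM.surjective_characterMap⟩)
    hM.continuous_characterMap

theorem characterMap_graph (p : homeoGraph hM.spectrumHomeo) : hM.characterMap p.1.1 = p.1.2 :=
  p.2

/-! ### `M` as the bimodule of sections -/

/-- The left inner product, as a kernel over the graph of the homeomorphism of spectra. -/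
noncomputable def kernel : RankOneKernel M (homeoGraph hM.spectrumHomeo) where
  ker x y := (graphFst hM.spectrumHomeo).compStarAlgEquiv' ℂ ℂ (gelfandStarTransform A (linner x y))
  conj_symm x y p := by
    change star (p.1.1 (linner x y : A)) = p.1.1 (linner y x : A)
    rw [← map_star, hM.star_linner]
  exchange x y v w p := hM.apply_linner_exchange p.1.1 x y v w
  frame p := hM.unitAt p.1.1
  frame_self p := hM.linner_unitAt p.1.1

/-- The imprimitivity bimodule of continuous sections of the associated line bundle. -/
abbrev SectionBimodule : Type _ :=
  Twist (gelfandStarTransform A) (gelfandStarTransform B)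
    (AssociatedBimodule hM.spectrumHomeo hM.kernel.lineBundle)

/-- The elements of `M` as sections of the line bundle. -/
noncomputable def sectionMap : M → hM.SectionBimodule := hM.kernel.toSection

theorem sectionMap_add (x y : M) : hM.sectionMap (x + y) = hM.sectionMap x + hM.sectionMap y := by
  refine Subtype.ext (funext fun p => ?_)
  change p.1.1 (linner (x + y) _ : A) = p.1.1 (linner x _ : A) + p.1.1 (linner y _ : A)
  rw [hM.linner_add_left, map_add]

theorem sectionMap_smul (a : A) (x : M) : hM.sectionMap (a • x) = a • hM.sectionMap x := by
  refine Subtype.ext (funext fun p => ?_)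
  change p.1.1 (linner (a • x) _ : A) = p.1.1 a * p.1.1 (linner x _ : A)
  rw [hM.linner_smul_left, map_mul]

theorem sectionMap_op_smul (b : B) (x : M) :
    hM.sectionMap (op b • x) = op b • hM.sectionMap x := by
  refine Subtype.ext (funext fun p => ?_)
  change p.1.1 (linner (op b • x) _ : A) = p.1.2 b * p.1.1 (linner x _ : A)
  rw [hM.apply_linner_op_smul, hM.characterMap_graph]

theorem linner_sectionMap (x y : M) :
    linner (A := A) (hM.sectionMap x) (hM.sectionMap y) = linner x y := by
  refine (EquivLike.toEquiv (gelfandStarTransform A)).symm_apply_eq.2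
    ((EquivLike.toEquiv ((graphFst hM.spectrumHomeo).compStarAlgEquiv' ℂ ℂ)).symm_apply_eq.2 ?_)
  ext p
  exact hM.kernel.inner_toSection y x p

theorem rinner_sectionMap (x y : M) :
    rinner (B := B) (hM.sectionMap x) (hM.sectionMap y) = rinner x y := by
  refine (EquivLike.toEquiv (gelfandStarTransform B)).symm_apply_eq.2
    ((EquivLike.toEquiv ((graphSnd hM.spectrumHomeo).compStarAlgEquiv' ℂ ℂ)).symm_apply_eq.2 ?_)
  ext p
  refine (hM.kernel.inner_toSection x y p).trans ?_
  change p.1.1 (linner y x : A) = p.1.2 (rinner x y : B)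
  rw [← hM.characterMap_graph, hM.characterMap_rinner]

theorem injective_sectionMap : Function.Injective hM.sectionMap := by
  intro x y h
  refine hM.ext_linner fun z => ?_
  rw [← hM.linner_sectionMap, h, hM.linner_sectionMap]

/-- `sectionMap` as an `A`-linear map. -/
noncomputable def sectionLinearMap : M →ₗ[A] hM.SectionBimodule where
  toFun := hM.sectionMap
  map_add' := hM.sectionMap_add
  map_smul' := hM.sectionMap_smul

/-- The coefficient `⟨y,σ⟩` is a function on the graph, hence comes from some `c` in `A`, and the
product is the section of `c • x`. -/
theorem linner_smul_mem_range (x y : M) (σ : hM.kernel.lineBundle.Sections) :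
    (linner x y : A) • (show hM.SectionBimodule from σ) ∈ hM.sectionLinearMap.range := by
  obtain ⟨c, hc⟩ := ((EquivLike.surjective ((graphFst hM.spectrumHomeo).compStarAlgEquiv' ℂ ℂ)).comp
    (EquivLike.surjective (gelfandStarTransform A))) (rinner (hM.kernel.toSection y) σ)
  refine ⟨c • x, (hM.sectionMap_smul c x).trans ?_⟩
  refine Eq.trans ?_ (hM.kernel.ker_smul_section x y σ).symm
  exact congrArg (fun f : C(homeoGraph hM.spectrumHomeo, ℂ) => f • hM.kernel.toSection x) hc

theorem surjective_sectionMap : Function.Surjective hM.sectionMap := by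
  intro σ
  -- The `a` for which `a • σ` comes from `M` form an ideal; it contains all inner products, hence
  -- 1.
  have hle : Ideal.span {a : A | ∃ x y : M, linner x y = a} ≤
      hM.sectionLinearMap.range.comap (LinearMap.toSpanSingleton A hM.SectionBimodule σ) := by
    refine Submodule.span_le.2 ?_
    rintro _ ⟨x, y, rfl⟩
    exact hM.linner_smul_mem_range x y σ
  rw [hM.span_linner] at hle
  obtain ⟨x, hx⟩ := hle (Submodule.mem_top (x := (1 : A)))
  exact ⟨x, hx.trans (one_smul A σ)⟩

/-- An imprimitivity bimodule is isomorphic to the bimodule of sections of its line bundle. -/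
noncomputable def isoSections : HilbertBimoduleIso A B M hM.SectionBimodule where
  toEquiv := Equiv.ofBijective _ ⟨hM.injective_sectionMap, hM.surjective_sectionMap⟩
  map_add' := hM.sectionMap_add
  map_smul_left := hM.sectionMap_smul
  map_smul_right := hM.sectionMap_op_smul
  map_linner := hM.linner_sectionMap
  map_rinner := hM.rinner_sectionMap

end CommCStarAlgebra

end IsImprimitivityBimodule

theorem mainTheorem1 {A B M : Type*} [CommCStarAlgebra A] [CommCStarAlgebra B] [AddCommGroup M]
    [Module A M] [Module Bᵐᵒᵖ M] [LeftPairing A M] [RightPairing B M]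
    (hM : IsImprimitivityBimodule A B M) :
    ∃ (R : characterSpace ℂ A ≃ₜ characterSpace ℂ B)
      (E : HermitianLineBundle.{_, 0} (homeoGraph R)),
      Nonempty (HilbertBimoduleIso A B M
        (Twist (gelfandStarTransform A) (gelfandStarTransform B) (AssociatedBimodule R E))) :=
  ⟨hM.spectrumHomeo, hM.kernel.lineBundle, ⟨hM.isoSections⟩⟩
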